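/- Consider repeated bilateral trade with full feedback. In each round $t=1,2,\dots$ a seller/buyer pair with valuations $(S_t,B_t)\in[0,1]^2$ arrives, the learner posts a price $P_t\in[0,1]$, earns (without observing it) the gain from trade $\mathrm{gft}(P_t,S_t,B_t)$, where $\mathrm{gft}(p,s,b)=(b-s)\,\mathbb{I}\{s\le p\le b\}$, and then observes the pair $(S_t,B_t)$. A learner's strategy $\alpha$ is a sequence of measurable functions that give $P_t=\alpha_t(U_1,\dots,U_t,(S_1,B_1),\dots,(S_{t-1},B_{t-1}))$, where $U_1,U_2,\dots$ are i.i.d. uniform on $[0,1]$ and independent of the valuations. The regret of $\alpha$ over the horizon $T$, when $(S_1,B_1),(S_2,B_2),\dots$ are i.i.d. with law $\mathcal D$, is \[ R_T^{\mathcal D}(\alpha)=\sup_{p\in[0,1]}\mathbb{E}\Big[\sum_{t=1}^T \mathrm{gft}(p,S_t,B_t)-\sum_{t=1}^T\mathrm{gft}(P_t,S_t,B_t)\Big]. \] Theorem. For every real $M\ge 4$ and every horizon $T\in\mathbb{N}$, \[ R_T^\star:=\inf_{\alpha}\ \sup_{\mathcal D}\ R_T^{\mathcal D}(\alpha)\ \ge\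 \frac{1}{160}\sqrt{T}, \] where the infimum is over all strategies of the learner and the supremum is over all laws $\mathcal D=\mu_S\otimes\mu_B$ on $[0,1]^2$ (so that the two valuations in a pair are independent) with densities bounded by $M$. The bound holds both when this means that $\mu_S$ and $\mu_B$ each have a density with respect to Lebesgue measure on $[0,1]$ that is bounded by $M$, and when it means that $\mathcal D$ has a joint density with respect to Lebesgue measure on $[0,1]^2$ that is bounded by $M$. -/

import Mathlib

open MeasureTheory

/-- A sequential game with player's actions `X`, adversary's actions `Y` and feedback space `Z`:
a measurable reward with values in `[0,1]`, a measurable feedback function, and the adversary's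
behavior, a set of probability measures on sequences of adversary's actions. -/
structure SequentialGame (X Y Z : Type*) [MeasurableSpace X] [MeasurableSpace Y]
    [MeasurableSpace Z] where
  reward : X → Y → ℝ
  reward_mem : ∀ x y, reward x y ∈ Set.Icc (0 : ℝ) 1
  measurable_reward : Measurable fun q : X × Y => reward q.1 q.2
  feedback : X → Y → Z
  measurable_feedback : Measurable fun q : X × Y => feedback q.1 q.2
  behavior : Set (ProbabilityMeasure (ℕ → Y))

/-- A (randomized) strategy. Rounds are numbered `0, 1, 2, …`; in round `t` the action is a
measurable function of the `t + 1` random numbers drawn so far and of the `t` past feedbacks. -/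
structure PlayerStrategy (X Z : Type*) [MeasurableSpace X] [MeasurableSpace Z] where
  act : (t : ℕ) → (Fin (t + 1) → unitInterval) → (Fin t → Z) → X
  measurable_act : ∀ t, Measurable fun q : (Fin (t + 1) → unitInterval) × (Fin t → Z) =>
    act t q.1 q.2

namespace SequentialGame

variable {X Y Z : Type*} [MeasurableSpace X] [MeasurableSpace Y] [MeasurableSpace Z]

/-- The action played in round `t` when the adversary plays `y` and the player's random numbers
are `u`: the strategy applied to `u 0, …, u t` and to the feedbacks of rounds `0, …, t - 1`. -/
def action (G : SequentialGame X Y Z) (α : PlayerStrategy X Z) (y : ℕ → Y)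
    (u : ℕ → unitInterval) (t : ℕ) : X :=
  α.act t (fun i => u i) (fun i => G.feedback (action G α y u i) (y i))
termination_by t
decreasing_by exact i.isLt

/-- The scenario of `ν`: the adversary's sequence has law `ν`, and the player's random numbers
are i.i.d. uniform on `[0,1]` and independent of it. -/
noncomputable def scenario (ν : ProbabilityMeasure (ℕ → Y)) :
    Measure ((ℕ → Y) × (ℕ → unitInterval)) :=
  (ν : Measure (ℕ → Y)).prod (Measure.infinitePi fun _ : ℕ => (volume : Measure unitInterval))

/-- The regret over `T` rounds of `α` against `ν`:
`sup_x E[∑_{t < T} ρ(x, Y_t) - ∑_{t < T} ρ(X_t, Y_t)]`. -/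
noncomputable def regret (G : SequentialGame X Y Z) (α : PlayerStrategy X Z)
    (ν : ProbabilityMeasure (ℕ → Y)) (T : ℕ) : EReal :=
  ⨆ x : X, ((∫ ω, (∑ t ∈ Finset.range T, G.reward x (ω.1 t)
    - ∑ t ∈ Finset.range T, G.reward (G.action α ω.1 ω.2 t) (ω.1 t)) ∂(scenario ν) : ℝ) : EReal)

/-- The worst-case regret of `α` over the adversary's behavior. -/
noncomputable def worstCaseRegret (G : SequentialGame X Y Z) (α : PlayerStrategy X Z) (T : ℕ) :
    EReal :=
  ⨆ ν ∈ G.behavior, G.regret α ν T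

/-- The minimax regret: the infimum over all strategies of the worst-case regret. -/
noncomputable def minimaxRegret (G : SequentialGame X Y Z) (T : ℕ) : EReal :=
  ⨅ α : PlayerStrategy X Z, G.worstCaseRegret α T

end SequentialGame

namespace BilateralTrade

/-- The gain from trade at price `p` for the valuations `y = (s, b)` of the seller and buyer. -/
noncomputable def gainFromTrade (p : unitInterval) (y : unitInterval × unitInterval) : ℝ :=
  if y.1 ≤ p ∧ p ≤ y.2 then (y.2 : ℝ) - y.1 else 0

theorem gainFromTrade_mem (p : unitInterval) (y : unitInterval × unitInterval) :
    gainFromTrade p y ∈ Set.Icc (0 : ℝ) 1 := by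
  unfold gainFromTrade
  split_ifs with h
  · have h1 : (y.1 : ℝ) ≤ y.2 := h.1.trans h.2
    have h2 := y.1.2.1
    have h3 := y.2.2.2
    exact ⟨by linarith, by linarith⟩
  · simp

theorem measurable_gainFromTrade :
    Measurable fun q : unitInterval × (unitInterval × unitInterval) =>
      gainFromTrade q.1 q.2 := by
  unfold gainFromTrade
  refine Measurable.ite ?_ (by fun_prop) measurable_const
  exact (measurableSet_le (by fun_prop) (by fun_prop)).inter
    (measurableSet_le (by fun_prop) (by fun_prop))

/-- Bilateral trade with full feedback: the player posts a price in `[0,1]`, the reward is the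
gain from trade, and the feedback is the pair of valuations. -/
noncomputable def fullFeedbackGame
    (P : Set (ProbabilityMeasure (ℕ → unitInterval × unitInterval))) :
    SequentialGame unitInterval (unitInterval × unitInterval) (unitInterval × unitInterval) where
  reward := gainFromTrade
  reward_mem := gainFromTrade_mem
  measurable_reward := measurable_gainFromTrade
  feedback _ y := y
  measurable_feedback := measurable_snd
  behavior := P

/-- `μ` has a density with values in `[0, M]` with respect to the reference measure `volume`. -/
def HasDensityBoundedBy {E : Type*} [MeasureSpace E] (μ : Measure E) (M : ℝ) : Prop :=
  ∃ f : E → ℝ, Measurable f ∧ (∀ x, f x ∈ Set.Icc (0 : ℝ) M) ∧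
    μ = volume.withDensity fun x => ENNReal.ofReal (f x)

/-- (iid) + (iv): the pairs are i.i.d. and the seller's and the buyer's valuation in each pair
are independent. -/
def behaviorIV : Set (ProbabilityMeasure (ℕ → unitInterval × unitInterval)) :=
  {ν | ∃ μS μB : ProbabilityMeasure unitInterval,
    (ν : Measure (ℕ → unitInterval × unitInterval)) =
      Measure.infinitePi fun _ : ℕ => (μS : Measure unitInterval).prod μB}

/-- (iid) + (bd): the pairs are i.i.d. with a joint density bounded by `M`. -/
def behaviorBD (M : ℝ) : Set (ProbabilityMeasure (ℕ → unitInterval × unitInterval)) :=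
  {ν | ∃ μ : ProbabilityMeasure (unitInterval × unitInterval),
    HasDensityBoundedBy (μ : Measure (unitInterval × unitInterval)) M ∧
    (ν : Measure (ℕ → unitInterval × unitInterval)) =
      Measure.infinitePi fun _ : ℕ => (μ : Measure (unitInterval × unitInterval))}

/-- (iid) + (iv), where the seller's valuation and the buyer's valuation each have a density
bounded by `M`. -/
def behaviorIVMarginalBD (M : ℝ) :
    Set (ProbabilityMeasure (ℕ → unitInterval × unitInterval)) :=
  {ν | ∃ μS μB : ProbabilityMeasure unitInterval,
    HasDensityBoundedBy (μS : Measure unitInterval) M ∧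
    HasDensityBoundedBy (μB : Measure unitInterval) M ∧
    (ν : Measure (ℕ → unitInterval × unitInterval)) =
      Measure.infinitePi fun _ : ℕ => (μS : Measure unitInterval).prod μB}

end BilateralTrade

/-! The proof is a two-point (Le Cam) argument. The seller's law is uniform on `[0, 1/4] ∪ (1/2,
3/4]` and the buyer's is uniform on `[0, 1/2] ∪ [3/4, 1]`. The gaps in the supports make `1/4` or
`3/4` at least as good as any other price, and both earn `1/6` on average. Shifting a relative
weight `c` from the upper to the lower block of sellers changes these values to `(1 + c)/6` and `1/6
+ c/12`. So `1/4` wins by `ε/12` when `c = ε`, `3/4` wins by `ε/12` when `c = -ε`, and under the two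
tilts the gaps of any price add up to at least `ε/12` (`integral_gainFromTrade_le`).

With full feedback the learner sees i.i.d. samples whatever it plays. With `ε = 1/(4√T)` the laws of
`t ≤ T` samples under the two tilts share mass at least `7/10` (`overlap_bound`), so in each round
the two expected gaps add up to at least `7/10 · ε/12` (`two_point_bound`). Summing over the rounds,
one of the two regrets is at least `7/20 · ε/12 · T = (7/960) √T`, which exceeds `√T/160`
(`le_minimaxRegret_of_two_point`). -/

/-! ### Finite histories of i.i.d. sequences. -/

theorem map_infinitePi_fin {Y : Type*} [MeasurableSpace Y] (μ : Measure Y)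
    [IsProbabilityMeasure μ] (n : ℕ) :
    (Measure.infinitePi fun _ : ℕ => μ).map (fun y (i : Fin n) => y i)
      = Measure.pi fun _ : Fin n => μ := by
  symm
  refine Measure.pi_eq fun s hs => ?_
  have hm : Measurable fun (y : ℕ → Y) (i : Fin n) => y i := by fun_prop
  rw [Measure.map_apply hm (.univ_pi hs)]
  have : (fun (y : ℕ → Y) (i : Fin n) => y i) ⁻¹' Set.univ.pi s
      = Set.pi (Finset.range n) fun i => if hi : i < n then s ⟨i, hi⟩ else Set.univ := by
    ext y
    simp only [Set.mem_preimage, Set.mem_pi, Set.mem_univ, true_imp_iff, Finset.coe_range,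
      Set.mem_Iio]
    constructor
    · intro h i hi
      simpa [hi] using h ⟨i, hi⟩
    · intro h i
      simpa using h i i.2
  rw [this, Measure.infinitePi_pi, Finset.prod_range]
  · simp
  · intro i hi
    simp only [Finset.mem_range] at hi
    simpa [hi] using hs ⟨i, hi⟩

/-- Under an i.i.d. law the first `t` coordinates and the next one are independent. -/
theorem map_infinitePi_history {Y : Type*} [MeasurableSpace Y] (μ : Measure Y)
    [IsProbabilityMeasure μ] (t : ℕ) :
    (Measure.infinitePi fun _ : ℕ => μ).map (fun y => (y t, fun i : Fin t => y i))
      = μ.prod (Measure.pi fun _ : Fin t => μ) := by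
  rw [← (measurePreserving_piFinSuccAbove (fun _ : Fin (t + 1) => μ) (Fin.last t)).map_eq,
    ← map_infinitePi_fin μ (t + 1), Measure.map_map (by fun_prop) (by fun_prop)]
  congr 1
  ext y i
  · simp
  · simp [Fin.init]

/-- The action depends on the past only, so the current sample can be integrated out first, by
independence and Fubini. -/
theorem integral_infinitePi_history {X Y : Type*} [MeasurableSpace X] [MeasurableSpace Y]
    (μ : Measure Y) [IsProbabilityMeasure μ] {G : X → Y → ℝ} {C : ℝ}
    (hG : Measurable fun q : X × Y => G q.1 q.2) (hGC : ∀ x y, |G x y| ≤ C)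
    {t : ℕ} {a : (Fin t → Y) → X} (ha : Measurable a) :
    ∫ y, G (a fun i => y i) (y t) ∂(Measure.infinitePi fun _ : ℕ => μ)
      = ∫ z, (∫ y, G (a z) y ∂μ) ∂(Measure.pi fun _ : Fin t => μ) := by
  have hm : Measurable fun q : Y × (Fin t → Y) => G (a q.2) q.1 :=
    hG.comp ((ha.comp measurable_snd).prodMk measurable_fst)
  rw [← integral_prod_symm (f := fun q : Y × (Fin t → Y) => G (a q.2) q.1)
      (Integrable.of_bound hm.aestronglyMeasurable C (ae_of_all _ fun q => hGC _ _)),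
    ← map_infinitePi_history, integral_map (by fun_prop) hm.aestronglyMeasurable]

/-! ### Tilted product laws and the two-point inequality. -/

/-- The product of `n` copies of a tilted law is the tilt of the product. -/
theorem pi_withDensity_ofReal {Y : Type*} [MeasurableSpace Y] (μ : Measure Y)
    [IsProbabilityMeasure μ] {f : Y → ℝ} (hf0 : ∀ y, 0 ≤ f y)
    (hfi : Integrable f μ)
    [IsProbabilityMeasure (μ.withDensity fun y => ENNReal.ofReal (f y))] (n : ℕ) :
    Measure.pi (fun _ : Fin n => μ.withDensity fun y => ENNReal.ofReal (f y))
      = (Measure.pi fun _ : Fin n => μ).withDensity fun z => ENNReal.ofReal (∏ i, f (z i)) := by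
  refine Measure.pi_eq fun s hs => ?_
  rw [withDensity_apply _ (.univ_pi hs), Measure.restrict_pi_pi,
    ← ofReal_integral_eq_lintegral_ofReal, integral_fintype_prod_eq_prod,
    ENNReal.ofReal_prod_of_nonneg]
  · refine Finset.prod_congr rfl fun i _ => ?_
    rw [withDensity_apply _ (hs i), ← ofReal_integral_eq_lintegral_ofReal hfi.restrict
      (ae_of_all _ hf0)]
  · exact fun i _ => integral_nonneg hf0
  · exact Integrable.fintype_prod fun i => hfi.restrict
  · exact ae_of_all _ fun z => Finset.prod_nonneg fun i _ => hf0 _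

theorem integral_withDensity_ofReal {Y : Type*} [MeasurableSpace Y] (μ : Measure Y)
    {f : Y → ℝ} (hf : Measurable f) (hf0 : ∀ y, 0 ≤ f y) (g : Y → ℝ) :
    ∫ y, g y ∂(μ.withDensity fun y => ENNReal.ofReal (f y)) = ∫ y, f y * g y ∂μ := by
  rw [integral_withDensity_eq_integral_toReal_smul hf.ennreal_ofReal (by simp)]
  simp [ENNReal.toReal_ofReal (hf0 _)]

theorem isProbabilityMeasure_withDensity_ofReal {Y : Type*} [MeasurableSpace Y] (μ : Measure Y)
    {f : Y → ℝ} (hf0 : ∀ y, 0 ≤ f y) (hfi : Integrable f μ) (h1 : ∫ y, f y ∂μ = 1) :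
    IsProbabilityMeasure (μ.withDensity fun y => ENNReal.ofReal (f y)) where
  measure_univ := by
    rw [withDensity_apply _ .univ, Measure.restrict_univ,
      ← ofReal_integral_eq_lintegral_ofReal hfi (ae_of_all _ hf0), h1, ENNReal.ofReal_one]

/-- Since `min a b = (a + b)/2 - |a - b|/2`, this is `|d| ≤ d² + 1/4`. It replaces total variation
by a second moment, which is explicit for product densities. -/
theorem half_add_sub_sq_le_min (a b : ℝ) : (a + b) / 2 - (a - b) ^ 2 / 2 - 1 / 8 ≤ min a b := by
  rcases le_total a b with h | h
  · rw [min_eq_left h]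
    nlinarith [sq_nonneg (b - a - 1 / 2)]
  · rw [min_eq_right h]
    nlinarith [sq_nonneg (a - b - 1 / 2)]

/-- Two symmetric tilts of a law by at most `1 / (4 √T)` overlap substantially over `t ≤ T`
independent samples. -/
theorem overlap_bound {Y : Type*} [MeasurableSpace Y] (μ : Measure Y)
    [IsProbabilityMeasure μ] {h : Y → ℝ} (hh : Measurable h) (hsq : ∀ y, h y ^ 2 = 1)
    (h0 : ∫ y, h y ∂μ = 0) {ε : ℝ} {t : ℕ} (hε : t * ε ^ 2 ≤ 1 / 16) (hε1 : ε ^ 2 ≤ 1) :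
    7 / 10 ≤ ∫ z, min (∏ i, (1 + ε * h (z i))) (∏ i, (1 - ε * h (z i)))
      ∂(Measure.pi fun _ : Fin t => μ) := by
  have hb : ∀ y, |h y| ≤ 1 := fun y => abs_le_one_iff_mul_self_le_one.2 (by nlinarith [hsq y])
  have hi : Integrable h μ := .of_bound hh.aestronglyMeasurable 1 (ae_of_all _ hb)
  have hlin : ∀ c : ℝ, ∫ y, (1 + c * h y) ∂μ = 1 := fun c => by
    rw [integral_add (integrable_const _) (hi.const_mul _), integral_const_mul, h0]
    simp
  have key : ∀ F : Y → ℝ, Integrable F μ →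
      Integrable (fun z : Fin t → Y => ∏ i, F (z i)) (Measure.pi fun _ : Fin t => μ) :=
    fun F hF => Integrable.fintype_prod fun _ => hF
  have hFi : ∀ c d : ℝ, Integrable (fun y => c + d * h y) μ :=
    fun c d => (integrable_const _).add (hi.const_mul _)
  set e := ε ^ 2 with he
  set P : (Fin t → Y) → ℝ := fun z => ∏ i, (1 + ε * h (z i)) with hP
  set Q : (Fin t → Y) → ℝ := fun z => ∏ i, (1 + -ε * h (z i)) with hQ
  have hQ' : ∀ z : Fin t → Y, ∏ i, (1 - ε * h (z i)) = Q z := fun z => by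
    simp only [hQ, neg_mul, sub_eq_add_neg]
  simp_rw [hQ']
  set A : (Fin t → Y) → ℝ := fun z => ∏ i, ((1 + e) + 2 * ε * h (z i)) with hA
  set B : (Fin t → Y) → ℝ := fun z => ∏ i, ((1 + e) + -2 * ε * h (z i)) with hB
  -- Because `h² = 1`, the squared likelihoods are again products of affine functions of `h`, and
  -- the cross term `P * Q` is constant.
  have hPA : ∀ z, P z ^ 2 = A z := fun z => by
    simp only [hP, hA, ← Finset.prod_pow]
    exact Finset.prod_congr rfl fun i _ => by rw [he]; linear_combination ε ^ 2 * hsq (z i)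
  have hQB : ∀ z, Q z ^ 2 = B z := fun z => by
    simp only [hQ, hB, ← Finset.prod_pow]
    exact Finset.prod_congr rfl fun i _ => by rw [he]; linear_combination ε ^ 2 * hsq (z i)
  have hPQ : ∀ z, P z * Q z = (1 - e) ^ t := fun z => by
    simp only [hP, hQ, ← Finset.prod_mul_distrib]
    rw [Finset.prod_congr rfl fun i _ => (show _ = 1 - e by
      rw [he]; linear_combination (-ε ^ 2) * hsq (z i))]
    simp
  have iP : ∫ z, P z ∂(Measure.pi fun _ : Fin t => μ) = 1 := by
    rw [integral_fintype_prod_eq_pow (f := fun y => 1 + ε * h y), hlin, one_pow]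
  have iQ : ∫ z, Q z ∂(Measure.pi fun _ : Fin t => μ) = 1 := by
    rw [integral_fintype_prod_eq_pow (f := fun y => 1 + -ε * h y), hlin, one_pow]
  have hlin2 : ∀ d : ℝ, ∫ y, ((1 + e) + d * h y) ∂μ = 1 + e := fun d => by
    rw [integral_add (integrable_const _) (hi.const_mul _), integral_const_mul, h0]
    simp
  have iA : ∫ z, A z ∂(Measure.pi fun _ : Fin t => μ) = (1 + e) ^ t := by
    rw [integral_fintype_prod_eq_pow (f := fun y => (1 + e) + 2 * ε * h y), hlin2,
      Fintype.card_fin]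
  have iB : ∫ z, B z ∂(Measure.pi fun _ : Fin t => μ) = (1 + e) ^ t := by
    rw [integral_fintype_prod_eq_pow (f := fun y => (1 + e) + -2 * ε * h y), hlin2,
      Fintype.card_fin]
  have IP : Integrable P (Measure.pi fun _ : Fin t => μ) := key _ (hFi _ _)
  have IQ : Integrable Q (Measure.pi fun _ : Fin t => μ) := key _ (hFi _ _)
  have IA : Integrable A (Measure.pi fun _ : Fin t => μ) := key _ (hFi _ _)
  have IB : Integrable B (Measure.pi fun _ : Fin t => μ) := key _ (hFi _ _)
  have hlow : ∀ z, (P z + Q z) / 2 - (A z + B z) / 2 + ((1 - e) ^ t - 1 / 8)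
      ≤ min (P z) (Q z) := fun z => by
    have := half_add_sub_sq_le_min (P z) (Q z)
    nlinarith [hPA z, hQB z, hPQ z]
  -- `exp (1/16) ≤ 1 / (1 - 1/16)`, from `1 + x ≤ exp x` at `x = -1/16`.
  have h1 : (1 + e) ^ t ≤ 16 / 15 := by
    have h2 : (1 + e) ^ t ≤ Real.exp (t * e) := by
      rw [Real.exp_nat_mul]
      exact pow_le_pow_left₀ (by positivity) (by linarith [Real.add_one_le_exp e]) _
    have h3 : Real.exp (t * e) ≤ Real.exp (1 / 16) := Real.exp_le_exp.2 hε
    have h4 : 1 - 1 / 16 ≤ Real.exp (-(1 / 16)) := by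
      linarith [Real.add_one_le_exp (-(1 / 16 : ℝ))]
    have h5 : Real.exp (1 / 16) * Real.exp (-(1 / 16)) = 1 := by
      rw [← Real.exp_add]; simp
    nlinarith [Real.exp_pos (1 / 16)]
  -- Bernoulli's inequality.
  have h2 : 15 / 16 ≤ (1 - e) ^ t := by
    have := one_add_mul_le_pow (a := -e) (by linarith) t
    rw [← sub_eq_add_neg] at this
    linarith
  have I1 : Integrable (fun z => (P z + Q z) / 2) (Measure.pi fun _ : Fin t => μ) :=
    (IP.add IQ).div_const 2
  have I2 : Integrable (fun z => (A z + B z) / 2) (Measure.pi fun _ : Fin t => μ) :=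
    (IA.add IB).div_const 2
  have I3 : Integrable (fun z => (P z + Q z) / 2 - (A z + B z) / 2)
    (Measure.pi fun _ : Fin t => μ) := I1.sub I2
  -- Numerically, `1 - 16/15 + 15/16 - 1/8 = 179/240 > 7/10`.
  calc (7 / 10 : ℝ) ≤ 1 - (1 + e) ^ t + ((1 - e) ^ t - 1 / 8) := by linarith
    _ = ∫ z, ((P z + Q z) / 2 - (A z + B z) / 2 + ((1 - e) ^ t - 1 / 8))
        ∂(Measure.pi fun _ : Fin t => μ) := by
      rw [integral_add I3 (integrable_const _), integral_sub I1 I2, integral_div,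
        integral_div, integral_add IP IQ, integral_add IA IB, iP, iQ, iA, iB]
      simp
    _ ≤ _ := integral_mono (I3.add (integrable_const _)) (IP.inf IQ) hlow

/-- Two actions cannot both be good after `t` samples: whatever is played as a function of the
samples, the losses under the two tilts add up to a fraction of `δ`. -/
theorem two_point_bound {X Y : Type*} [MeasurableSpace X] [MeasurableSpace Y] (μ : Measure Y)
    [IsProbabilityMeasure μ] {h : Y → ℝ} (hh : Measurable h) (hsq : ∀ y, h y ^ 2 = 1)
    (h0 : ∫ y, h y ∂μ = 0) {ε : ℝ} {t : ℕ} (hε : t * ε ^ 2 ≤ 1 / 16) (hε1 : |ε| ≤ 1)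
    [IsProbabilityMeasure (μ.withDensity fun y => ENNReal.ofReal (1 + ε * h y))]
    [IsProbabilityMeasure (μ.withDensity fun y => ENNReal.ofReal (1 - ε * h y))]
    {gp gm : X → ℝ} {C δ : ℝ} (hgp : Measurable gp) (hgm : Measurable gm)
    (hp0 : ∀ x, 0 ≤ gp x) (hm0 : ∀ x, 0 ≤ gm x) (hpC : ∀ x, gp x ≤ C) (hmC : ∀ x, gm x ≤ C)
    (hδ : 0 ≤ δ) (hsum : ∀ x, δ ≤ gp x + gm x) {a : (Fin t → Y) → X} (ha : Measurable a) :
    7 / 10 * δ ≤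
      ∫ z, gp (a z) ∂(Measure.pi fun _ : Fin t =>
        μ.withDensity fun y => ENNReal.ofReal (1 + ε * h y))
      + ∫ z, gm (a z) ∂(Measure.pi fun _ : Fin t =>
        μ.withDensity fun y => ENNReal.ofReal (1 - ε * h y)) := by
  have hb : ∀ y, |h y| ≤ 1 := fun y => abs_le_one_iff_mul_self_le_one.2 (by nlinarith [hsq y])
  have hi : Integrable h μ := .of_bound hh.aestronglyMeasurable 1 (ae_of_all _ hb)
  have hεh : ∀ y, |ε * h y| ≤ 1 := fun y => by
    rw [abs_mul]
    exact mul_le_one₀ hε1 (abs_nonneg _) (hb y)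
  have hfp : ∀ y, 0 ≤ 1 + ε * h y := fun y => by linarith [(abs_le.1 (hεh y)).1]
  have hfm : ∀ y, 0 ≤ 1 - ε * h y := fun y => by linarith [(abs_le.1 (hεh y)).2]
  have hIp : Integrable (fun y => 1 + ε * h y) μ := (integrable_const _).add (hi.const_mul _)
  have hIm : Integrable (fun y => 1 - ε * h y) μ := (integrable_const _).sub (hi.const_mul _)
  -- Both expectations become integrals against the untilted product law, where the likelihoods can
  -- be compared pointwise.
  rw [pi_withDensity_ofReal μ hfp hIp, pi_withDensity_ofReal μ hfm hIm,
    integral_withDensity_ofReal _ (by fun_prop) (fun z => Finset.prod_nonneg fun i _ => hfp _),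
    integral_withDensity_ofReal _ (by fun_prop) (fun z => Finset.prod_nonneg fun i _ => hfm _)]
  set P : (Fin t → Y) → ℝ := fun z => ∏ i, (1 + ε * h (z i)) with hP
  set Q : (Fin t → Y) → ℝ := fun z => ∏ i, (1 - ε * h (z i)) with hQ
  have IP : Integrable P (Measure.pi fun _ : Fin t => μ) := Integrable.fintype_prod fun _ => hIp
  have IQ : Integrable Q (Measure.pi fun _ : Fin t => μ) := Integrable.fintype_prod fun _ => hIm
  have P0 : ∀ z, 0 ≤ P z := fun z => Finset.prod_nonneg fun i _ => hfp _
  have Q0 : ∀ z, 0 ≤ Q z := fun z => Finset.prod_nonneg fun i _ => hfm _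
  have IPg : Integrable (fun z => P z * gp (a z)) (Measure.pi fun _ : Fin t => μ) :=
    IP.mul_bdd (c := C) (hgp.comp ha).aestronglyMeasurable
      (ae_of_all _ fun z => by rw [Real.norm_of_nonneg (hp0 _)]; exact hpC _)
  have IQg : Integrable (fun z => Q z * gm (a z)) (Measure.pi fun _ : Fin t => μ) :=
    IQ.mul_bdd (c := C) (hgm.comp ha).aestronglyMeasurable
      (ae_of_all _ fun z => by rw [Real.norm_of_nonneg (hm0 _)]; exact hmC _)
  have hov := overlap_bound μ hh hsq h0 hε (by rw [← sq_abs]; nlinarith [abs_nonneg ε])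
  calc 7 / 10 * δ ≤ (∫ z, min (P z) (Q z) ∂(Measure.pi fun _ : Fin t => μ)) * δ := by gcongr
    _ = ∫ z, min (P z) (Q z) * δ ∂(Measure.pi fun _ : Fin t => μ) := by rw [integral_mul_const]
    _ ≤ ∫ z, (P z * gp (a z) + Q z * gm (a z)) ∂(Measure.pi fun _ : Fin t => μ) := by
      refine integral_mono ((IP.inf IQ).mul_const δ) (IPg.add IQg) fun z => ?_
      calc min (P z) (Q z) * δ ≤ min (P z) (Q z) * (gp (a z) + gm (a z)) :=
            mul_le_mul_of_nonneg_left (hsum _) (le_min (P0 z) (Q0 z))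
        _ ≤ P z * gp (a z) + Q z * gm (a z) := by
          rw [mul_add]
          exact add_le_add (mul_le_mul_of_nonneg_right (min_le_left _ _) (hp0 _))
            (mul_le_mul_of_nonneg_right (min_le_right _ _) (hm0 _))
    _ = _ := integral_add IPg IQg

/-! ### Regret under full feedback against i.i.d. adversaries. -/

namespace SequentialGame

variable {X Y : Type*} [MeasurableSpace X] [MeasurableSpace Y]

theorem action_of_feedback_eq (G : SequentialGame X Y Y) (hfb : ∀ x y, G.feedback x y = y)
    (α : PlayerStrategy X Y) (y : ℕ → Y) (u : ℕ → unitInterval) (t : ℕ) :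
    G.action α y u t = α.act t (fun i => u i) (fun i => y i) := by
  rw [action]
  simp only [hfb]

/-- With full feedback against an i.i.d. adversary, the expected regret with respect to a fixed
action is the expected sum of the gaps of the actions played. -/
theorem integral_scenario_eq (G : SequentialGame X Y Y) (hfb : ∀ x y, G.feedback x y = y)
    (α : PlayerStrategy X Y) (μ : Measure Y) [IsProbabilityMeasure μ]
    (ν : ProbabilityMeasure (ℕ → Y)) (hν : (ν : Measure (ℕ → Y)) = Measure.infinitePi fun _ => μ)
    (T : ℕ) (x : X) :
    Integrable (fun u : ℕ → unitInterval => ∑ t ∈ Finset.range T,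
        ∫ z, (∫ y, (G.reward x y - G.reward (α.act t (fun i => u i) z) y) ∂μ)
          ∂(Measure.pi fun _ : Fin t => μ)) (Measure.infinitePi fun _ => volume) ∧
    ∫ ω, (∑ t ∈ Finset.range T, G.reward x (ω.1 t)
        - ∑ t ∈ Finset.range T, G.reward (G.action α ω.1 ω.2 t) (ω.1 t)) ∂(scenario ν)
      = ∫ u, ∑ t ∈ Finset.range T,
        ∫ z, (∫ y, (G.reward x y - G.reward (α.act t (fun i => u i) z) y) ∂μ)
          ∂(Measure.pi fun _ : Fin t => μ)
          ∂(Measure.infinitePi fun _ : ℕ => (volume : Measure unitInterval)) := by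
  have hr : ∀ x y, |G.reward x y| ≤ 1 := fun x y =>
    abs_le.2 ⟨by linarith [(G.reward_mem x y).1], (G.reward_mem x y).2⟩
  have hd : ∀ x x' y, |G.reward x y - G.reward x' y| ≤ 1 := fun x x' y =>
    abs_le.2 ⟨by linarith [(G.reward_mem x y).1, (G.reward_mem x' y).2],
      by linarith [(G.reward_mem x y).2, (G.reward_mem x' y).1]⟩
  have hmd : Measurable fun q : X × Y => G.reward x q.2 - G.reward q.1 q.2 :=
    (G.measurable_reward.comp (measurable_const.prodMk measurable_snd)).sub G.measurable_reward
  have hact : ∀ t, Measurable fun ω : (ℕ → Y) × (ℕ → unitInterval) =>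
      α.act t (fun i => ω.2 i) (fun i => ω.1 i) := fun t =>
    (α.measurable_act t).comp (by fun_prop :
      Measurable fun ω : (ℕ → Y) × (ℕ → unitInterval) =>
        ((fun i : Fin (t + 1) => ω.2 i), (fun i : Fin t => ω.1 i)))
  have hterm : ∀ t, Measurable fun ω : (ℕ → Y) × (ℕ → unitInterval) =>
      G.reward x (ω.1 t) - G.reward (α.act t (fun i => ω.2 i) (fun i => ω.1 i)) (ω.1 t) :=
    fun t => hmd.comp ((hact t).prodMk (by fun_prop))
  have hint : ∀ t, Integrable (fun ω : (ℕ → Y) × (ℕ → unitInterval) =>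
      G.reward x (ω.1 t) - G.reward (α.act t (fun i => ω.2 i) (fun i => ω.1 i)) (ω.1 t))
      (scenario ν) := fun t => by
    unfold scenario
    exact .of_bound (hterm t).aestronglyMeasurable 1 (ae_of_all _ fun ω => hd _ _ _)
  -- With the random numbers `u` frozen, the action of round `t` is a function of the first `t`
  -- samples alone.
  have hinner : ∀ (t : ℕ) (u : ℕ → unitInterval),
      ∫ y, (G.reward x (y t) - G.reward (α.act t (fun i => u i) (fun i => y i)) (y t))
        ∂(ν : Measure (ℕ → Y))
      = ∫ z, (∫ y, (G.reward x y - G.reward (α.act t (fun i => u i) z) y) ∂μ)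
          ∂(Measure.pi fun _ : Fin t => μ) := fun t u => by
    rw [hν]
    exact integral_infinitePi_history μ (G := fun x' y => G.reward x y - G.reward x' y) hmd
      (fun x' y => hd x x' y) ((α.measurable_act t).comp (measurable_const.prodMk measurable_id))
  refine ⟨?_, ?_⟩
  · refine integrable_finsetSum _ fun t _ => ?_
    simp_rw [← hinner]
    have := hint t
    unfold scenario at this
    exact this.integral_prod_right
  · have h1 : ∀ ω : (ℕ → Y) × (ℕ → unitInterval), (∑ t ∈ Finset.range T, G.reward x (ω.1 t)
        - ∑ t ∈ Finset.range T, G.reward (G.action α ω.1 ω.2 t) (ω.1 t))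
        = ∑ t ∈ Finset.range T, (G.reward x (ω.1 t)
          - G.reward (α.act t (fun i => ω.2 i) (fun i => ω.1 i)) (ω.1 t)) := fun ω => by
      simp only [action_of_feedback_eq G hfb, Finset.sum_sub_distrib]
    simp_rw [h1]
    have h2 := integrable_finsetSum (Finset.range T) fun t _ => hint t
    unfold scenario at h2 ⊢
    rw [integral_prod_symm _ h2]
    refine integral_congr_ae ?_
    -- Fubini gives integrable slices only for almost every `u`; countably many rounds share one
    -- null set.
    have h3 : ∀ᵐ u ∂(Measure.infinitePi fun _ : ℕ => (volume : Measure unitInterval)),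
        ∀ t, Integrable (fun y => G.reward x (y t)
          - G.reward (α.act t (fun i => u i) (fun i => y i)) (y t)) (ν : Measure (ℕ → Y)) :=
      ae_all_iff.2 fun t => by
        have := hint t
        unfold scenario at this
        exact this.prod_left_ae
    filter_upwards [h3] with u hu
    rw [integral_finsetSum _ fun t _ => hu t]
    exact Finset.sum_congr rfl fun t _ => hinner t u

/-- Two-point lower bound for games with full feedback. -/
theorem le_minimaxRegret_of_two_point (G : SequentialGame X Y Y)
    (hfb : ∀ x y, G.feedback x y = y) (μ : Measure Y) [IsProbabilityMeasure μ]
    {h : Y → ℝ} (hh : Measurable h) (hsq : ∀ y, h y ^ 2 = 1) (h0 : ∫ y, h y ∂μ = 0)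
    {ε : ℝ} {T : ℕ} (hε : T * ε ^ 2 ≤ 1 / 16) (hε1 : |ε| ≤ 1)
    [IsProbabilityMeasure (μ.withDensity fun y => ENNReal.ofReal (1 + ε * h y))]
    [IsProbabilityMeasure (μ.withDensity fun y => ENNReal.ofReal (1 - ε * h y))]
    {νp νm : ProbabilityMeasure (ℕ → Y)} (hpG : νp ∈ G.behavior) (hmG : νm ∈ G.behavior)
    (hνp : (νp : Measure (ℕ → Y)) =
      Measure.infinitePi fun _ => μ.withDensity fun y => ENNReal.ofReal (1 + ε * h y))
    (hνm : (νm : Measure (ℕ → Y)) =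
      Measure.infinitePi fun _ => μ.withDensity fun y => ENNReal.ofReal (1 - ε * h y))
    {xp xm : X} {δ : ℝ} (hδ : 0 ≤ δ)
    (hp0 : ∀ x, 0 ≤ ∫ y, (G.reward xp y - G.reward x y)
      ∂(μ.withDensity fun y => ENNReal.ofReal (1 + ε * h y)))
    (hm0 : ∀ x, 0 ≤ ∫ y, (G.reward xm y - G.reward x y)
      ∂(μ.withDensity fun y => ENNReal.ofReal (1 - ε * h y)))
    (hsum : ∀ x, δ ≤ ∫ y, (G.reward xp y - G.reward x y)
        ∂(μ.withDensity fun y => ENNReal.ofReal (1 + ε * h y))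
      + ∫ y, (G.reward xm y - G.reward x y)
        ∂(μ.withDensity fun y => ENNReal.ofReal (1 - ε * h y))) :
    ((7 / 20 * δ * T : ℝ) : EReal) ≤ G.minimaxRegret T := by
  refine le_iInf fun α => ?_
  have hgap : ∀ (μ' : Measure Y) [IsProbabilityMeasure μ'] (x' : X),
      Measurable (fun x => ∫ y, (G.reward x' y - G.reward x y) ∂μ') ∧
      ∀ x, ∫ y, (G.reward x' y - G.reward x y) ∂μ' ≤ 1 := fun μ' _ x' => by
    refine ⟨?_, fun x => ?_⟩
    · have : Measurable fun q : X × Y => G.reward x' q.2 - G.reward q.1 q.2 :=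
        (G.measurable_reward.comp (measurable_const.prodMk measurable_snd)).sub
          G.measurable_reward
      exact this.stronglyMeasurable.integral_prod_right'.measurable
    · have := norm_integral_le_of_norm_le_const (μ := μ') (C := 1)
        (f := fun y => G.reward x' y - G.reward x y) (ae_of_all _ fun y =>
          abs_le.2 ⟨by linarith [(G.reward_mem x' y).1, (G.reward_mem x y).2],
            by linarith [(G.reward_mem x' y).2, (G.reward_mem x y).1]⟩)
      simp only [probReal_univ, mul_one] at this
      exact (le_abs_self _).trans this
  obtain ⟨ip, ep⟩ := integral_scenario_eq G hfb α _ νp hνp T xp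
  obtain ⟨im, em⟩ := integral_scenario_eq G hfb α _ νm hνm T xm
  have hlow : 2 * (7 / 20 * δ * T) ≤
      (∫ ω, (∑ t ∈ Finset.range T, G.reward xp (ω.1 t)
        - ∑ t ∈ Finset.range T, G.reward (G.action α ω.1 ω.2 t) (ω.1 t)) ∂(scenario νp))
      + ∫ ω, (∑ t ∈ Finset.range T, G.reward xm (ω.1 t)
        - ∑ t ∈ Finset.range T, G.reward (G.action α ω.1 ω.2 t) (ω.1 t)) ∂(scenario νm) := by
    -- The random numbers have the same law in both scenarios, so the two regrets can be added for
    -- each fixed `u` and then round by round.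
    rw [ep, em, ← integral_add ip im]
    calc 2 * (7 / 20 * δ * T)
        = ∫ _u : ℕ → unitInterval, 2 * (7 / 20 * δ * T)
          ∂(Measure.infinitePi fun _ : ℕ => (volume : Measure unitInterval)) := by simp
      _ ≤ _ := by
        refine integral_mono (integrable_const _) (ip.add im) fun u => ?_
        simp only
        rw [← Finset.sum_add_distrib]
        calc 2 * (7 / 20 * δ * T) = ∑ _t ∈ Finset.range T, 7 / 10 * δ := by
              rw [Finset.sum_const, Finset.card_range, nsmul_eq_mul]; ring
          _ ≤ _ := Finset.sum_le_sum fun t ht => ?_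
        have ht' : (t : ℝ) ≤ T := by exact_mod_cast (Finset.mem_range.1 ht).le
        exact two_point_bound μ hh hsq h0
          ((mul_le_mul_of_nonneg_right ht' (sq_nonneg ε)).trans hε) hε1
          (hgap _ xp).1 (hgap _ xm).1 hp0 hm0 (hgap _ xp).2 (hgap _ xm).2 hδ hsum
          ((α.measurable_act t).comp (measurable_const.prodMk measurable_id))
  have hreg : ∀ {ν : ProbabilityMeasure (ℕ → Y)} (_ : ν ∈ G.behavior) (x : X),
      7 / 20 * δ * T ≤ (∫ ω, (∑ t ∈ Finset.range T, G.reward x (ω.1 t)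
        - ∑ t ∈ Finset.range T, G.reward (G.action α ω.1 ω.2 t) (ω.1 t)) ∂(scenario ν)) →
      ((7 / 20 * δ * T : ℝ) : EReal) ≤ G.worstCaseRegret α T := fun {ν} hν x hx =>
    (EReal.coe_le_coe_iff.2 hx).trans ((le_iSup (fun x : X => ((∫ ω,
      (∑ t ∈ Finset.range T, G.reward x (ω.1 t)
        - ∑ t ∈ Finset.range T, G.reward (G.action α ω.1 ω.2 t) (ω.1 t))
        ∂(scenario ν) : ℝ) : EReal)) x).trans
      (le_iSup₂ (f := fun ν (_ : ν ∈ G.behavior) => G.regret α ν T) ν hν))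
  -- If both regrets were below the bound, their sum would contradict `hlow`.
  by_contra hcon
  have h1 := mt (hreg hpG xp) hcon
  have h2 := mt (hreg hmG xm) hcon
  push Not at h1 h2
  linarith

end SequentialGame

/-! ### The hard instance: laws of the valuations and their moments. -/

namespace BilateralTrade

theorem integral_Ioc_unitInterval (φ : ℝ → ℝ) {a b : ℝ} (ha : 0 ≤ a) (hab : a ≤ b) (hb : b ≤ 1) :
    ∫ x : unitInterval, (if a < (x : ℝ) ∧ (x : ℝ) ≤ b then φ x else 0) = ∫ x in a..b, φ x := by
  rw [unitInterval.measurePreserving_coe.integral_comp unitInterval.measurableEmbedding_coe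
    (fun x : ℝ => if a < x ∧ x ≤ b then φ x else 0), intervalIntegral.integral_of_le hab]
  have : (fun x : ℝ => if a < x ∧ x ≤ b then φ x else 0) = (Set.Ioc a b).indicator φ := by
    ext x; simp [Set.indicator_apply]
  rw [this, integral_indicator measurableSet_Ioc, Measure.restrict_restrict measurableSet_Ioc,
    Set.inter_eq_left.2 (Set.Ioc_subset_Icc_self.trans (Set.Icc_subset_Icc ha hb))]

theorem integral_Icc_unitInterval (φ : ℝ → ℝ) {a b : ℝ} (ha : 0 ≤ a) (hab : a ≤ b) (hb : b ≤ 1) :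
    ∫ x : unitInterval, (if a ≤ (x : ℝ) ∧ (x : ℝ) ≤ b then φ x else 0) = ∫ x in a..b, φ x := by
  rw [unitInterval.measurePreserving_coe.integral_comp unitInterval.measurableEmbedding_coe
    (fun x : ℝ => if a ≤ x ∧ x ≤ b then φ x else 0), intervalIntegral.integral_of_le hab,
    ← integral_Icc_eq_integral_Ioc]
  have : (fun x : ℝ => if a ≤ x ∧ x ≤ b then φ x else 0) = (Set.Icc a b).indicator φ := by
    ext x; simp [Set.indicator_apply]
  rw [this, integral_indicator measurableSet_Icc, Measure.restrict_restrict measurableSet_Icc,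
    Set.inter_eq_left.2 (Set.Icc_subset_Icc ha hb)]

/-- The density of the seller's valuation before tilting. -/
noncomputable def sellerDensity (s : unitInterval) : ℝ :=
  if (s : ℝ) ≤ 1 / 4 ∨ (1 / 2 < (s : ℝ) ∧ (s : ℝ) ≤ 3 / 4) then 2 else 0

/-- The density of the buyer's valuation. -/
noncomputable def buyerDensity (b : unitInterval) : ℝ :=
  if (b : ℝ) ≤ 1 / 2 ∨ 3 / 4 ≤ (b : ℝ) then 4 / 3 else 0

/-- The direction in which the seller's law is tilted. -/
noncomputable def sellerTilt (s : unitInterval) : ℝ :=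
  if (s : ℝ) ≤ 1 / 4 then 1 else -1

@[fun_prop]
theorem measurable_sellerDensity : Measurable sellerDensity := by
  refine Measurable.ite ?_ measurable_const measurable_const
  exact (measurable_subtype_coe measurableSet_Iic).union
    (measurable_subtype_coe (measurableSet_Ioc (a := (1 / 2 : ℝ)) (b := 3 / 4)))

@[fun_prop]
theorem measurable_buyerDensity : Measurable buyerDensity := by
  refine Measurable.ite ?_ measurable_const measurable_const
  exact (measurable_subtype_coe measurableSet_Iic).union
    (measurable_subtype_coe measurableSet_Ici)

@[fun_prop]
theorem measurable_sellerTilt : Measurable sellerTilt :=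
  Measurable.ite (measurable_subtype_coe measurableSet_Iic) measurable_const measurable_const

theorem sellerDensity_nonneg (s : unitInterval) : 0 ≤ sellerDensity s := by
  unfold sellerDensity; split_ifs <;> norm_num

theorem sellerDensity_le (s : unitInterval) : sellerDensity s ≤ 2 := by
  unfold sellerDensity; split_ifs <;> norm_num

theorem buyerDensity_nonneg (b : unitInterval) : 0 ≤ buyerDensity b := by
  unfold buyerDensity; split_ifs <;> norm_num

theorem buyerDensity_le (b : unitInterval) : buyerDensity b ≤ 4 / 3 := by
  unfold buyerDensity; split_ifs <;> norm_num

theorem sellerTilt_sq (s : unitInterval) : sellerTilt s ^ 2 = 1 := by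
  unfold sellerTilt; split_ifs <;> norm_num

theorem abs_sellerTilt (s : unitInterval) : |sellerTilt s| = 1 := by
  unfold sellerTilt; split_ifs <;> norm_num

/-- The law of the seller's valuation before tilting. -/
noncomputable def sellerLaw : Measure unitInterval :=
  volume.withDensity fun s => ENNReal.ofReal (sellerDensity s)

/-- The law of the buyer's valuation. -/
noncomputable def buyerLaw : Measure unitInterval :=
  volume.withDensity fun b => ENNReal.ofReal (buyerDensity b)

theorem integral_sellerLaw (φ : unitInterval → ℝ) :
    ∫ s, φ s ∂sellerLaw = ∫ s, sellerDensity s * φ s :=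
  integral_withDensity_ofReal _ measurable_sellerDensity sellerDensity_nonneg φ

theorem integral_buyerLaw (φ : unitInterval → ℝ) :
    ∫ b, φ b ∂buyerLaw = ∫ b, buyerDensity b * φ b :=
  integral_withDensity_ofReal _ measurable_buyerDensity buyerDensity_nonneg φ

theorem integrable_ite_Icc (φ : ℝ → ℝ) (hφ : Continuous φ) (a b : ℝ) :
    Integrable fun x : unitInterval => if a ≤ (x : ℝ) ∧ (x : ℝ) ≤ b then φ x else 0 := by
  have hc : Continuous fun x : unitInterval => φ x := by fun_prop
  have hi : Integrable (fun x : unitInterval => φ x) := hc.integrable_of_hasCompactSupport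
    (HasCompactSupport.of_compactSpace _)
  have := hi.indicator (s := {x : unitInterval | a ≤ (x : ℝ) ∧ (x : ℝ) ≤ b})
    (measurable_subtype_coe measurableSet_Icc)
  refine this.congr (ae_of_all _ fun x => ?_)
  simp [Set.indicator_apply]

theorem integrable_ite_Ioc (φ : ℝ → ℝ) (hφ : Continuous φ) (a b : ℝ) :
    Integrable fun x : unitInterval => if a < (x : ℝ) ∧ (x : ℝ) ≤ b then φ x else 0 := by
  have hc : Continuous fun x : unitInterval => φ x := by fun_prop
  have hi : Integrable (fun x : unitInterval => φ x) := hc.integrable_of_hasCompactSupport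
    (HasCompactSupport.of_compactSpace _)
  have := hi.indicator (s := {x : unitInterval | a < (x : ℝ) ∧ (x : ℝ) ≤ b})
    (measurable_subtype_coe measurableSet_Ioc)
  refine this.congr (ae_of_all _ fun x => ?_)
  simp [Set.indicator_apply]

/-- Moments of the tilted seller's law below a price in the lower part of the support. -/
theorem integral_sellerLaw_low (φ : ℝ → ℝ) (c : ℝ) {p : unitInterval} (hp : (p : ℝ) ≤ 1 / 4) :
    ∫ s, (1 + c * sellerTilt s) * (if s ≤ p then φ s else 0) ∂sellerLaw
      = 2 * (1 + c) * ∫ x in (0 : ℝ)..p, φ x := by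
  rw [integral_sellerLaw, ← integral_Icc_unitInterval φ le_rfl p.2.1 p.2.2, ← integral_const_mul]
  refine integral_congr_ae (ae_of_all _ fun s => ?_)
  have hs := s.2.1
  by_cases h : s ≤ p
  · have h' : (s : ℝ) ≤ p := h
    have h4 : (s : ℝ) ≤ 1 / 4 := h'.trans hp
    simp only [sellerDensity, sellerTilt, h, h', h4, hs, true_or, and_self, if_true]
    ring
  · have h' : ¬ (s : ℝ) ≤ p := h
    simp [h, h']

/-- Moments of the tilted seller's law. -/
theorem integral_sellerLaw_high (φ : ℝ → ℝ) (hφ : Continuous φ) (c : ℝ) {p : unitInterval}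
    (hp : 3 / 4 ≤ (p : ℝ)) :
    ∫ s, (1 + c * sellerTilt s) * (if s ≤ p then φ s else 0) ∂sellerLaw
      = 2 * (1 + c) * (∫ x in (0 : ℝ)..(1 / 4), φ x)
        + 2 * (1 - c) * ∫ x in (1 / 2 : ℝ)..(3 / 4), φ x := by
  rw [integral_sellerLaw, ← integral_Icc_unitInterval φ le_rfl (by norm_num) (by norm_num),
    ← integral_Ioc_unitInterval φ (by norm_num) (by norm_num) (by norm_num), ← integral_const_mul,
    ← integral_const_mul, ← integral_add ((integrable_ite_Icc φ hφ _ _).const_mul _)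
      ((integrable_ite_Ioc φ hφ _ _).const_mul _)]
  refine integral_congr_ae (ae_of_all _ fun s => ?_)
  have hs := s.2.1
  by_cases h4 : (s : ℝ) ≤ 1 / 4
  · have h : s ≤ p := Subtype.coe_le_coe.1 (by linarith)
    have h2 : ¬ 1 / 2 < (s : ℝ) := by linarith
    simp only [sellerDensity, sellerTilt, h, h4, h2, hs, true_or, and_self, if_true, false_and,
      if_false]
    ring
  · by_cases h34 : 1 / 2 < (s : ℝ) ∧ (s : ℝ) ≤ 3 / 4
    · have h : s ≤ p := Subtype.coe_le_coe.1 (by linarith)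
      simp only [sellerDensity, sellerTilt, h, h4, h34, or_true, and_self, if_true, and_false,
        if_false]
      ring
    -- Off the support both sides vanish.
    · simp only [sellerDensity, h4, h34, or_self, and_false, if_false]
      ring

/-- Moments of the buyer's law above a price in the lower part of the support. -/
theorem integral_buyerLaw_low (φ : ℝ → ℝ) (hφ : Continuous φ) {p : unitInterval}
    (hp : (p : ℝ) ≤ 1 / 2) :
    ∫ b, (if p ≤ b then φ b else 0) ∂buyerLaw
      = 4 / 3 * (∫ x in (p : ℝ)..(1 / 2), φ x) + 4 / 3 * ∫ x in (3 / 4 : ℝ)..1, φ x := by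
  rw [integral_buyerLaw, ← integral_Icc_unitInterval φ p.2.1 hp (by norm_num),
    ← integral_Icc_unitInterval φ (a := 3 / 4) (by norm_num) (by norm_num) le_rfl,
    ← integral_const_mul, ← integral_const_mul,
    ← integral_add ((integrable_ite_Icc φ hφ _ _).const_mul _)
      ((integrable_ite_Icc φ hφ _ _).const_mul _)]
  refine integral_congr_ae (ae_of_all _ fun b => ?_)
  have hb := b.2.2
  by_cases h2 : (b : ℝ) ≤ 1 / 2
  · have h3 : ¬ 3 / 4 ≤ (b : ℝ) := by linarith
    by_cases h : p ≤ b
    · have h' : (p : ℝ) ≤ b := h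
      simp only [buyerDensity, h, h', h2, h3, true_or, and_self, false_and, if_true, if_false]
      ring
    · have h' : ¬ (p : ℝ) ≤ b := h
      simp [h, h', h3]
  · by_cases h3 : 3 / 4 ≤ (b : ℝ)
    · have h : p ≤ b := Subtype.coe_le_coe.1 (by linarith)
      simp only [buyerDensity, h, h2, h3, hb, or_true, and_false, and_self, if_true, if_false]
      ring
    · simp only [buyerDensity, h2, h3, or_self, and_false, false_and, if_false]
      ring

/-- Moments of the buyer's law above the price `3 / 4`. -/
theorem integral_buyerLaw_high (φ : ℝ → ℝ) {p : unitInterval} (hp : (p : ℝ) = 3 / 4) :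
    ∫ b, (if p ≤ b then φ b else 0) ∂buyerLaw = 4 / 3 * ∫ x in (3 / 4 : ℝ)..1, φ x := by
  rw [integral_buyerLaw, ← integral_Icc_unitInterval φ (a := 3 / 4) (by norm_num) (by norm_num)
    le_rfl, ← integral_const_mul]
  refine integral_congr_ae (ae_of_all _ fun b => ?_)
  have hb := b.2.2
  have hpb : p ≤ b ↔ 3 / 4 ≤ (b : ℝ) := by rw [← hp]; rfl
  by_cases h3 : 3 / 4 ≤ (b : ℝ)
  · simp [buyerDensity, hpb, h3, hb]
  · simp [hpb, h3]

theorem integrable_sellerDensity : Integrable sellerDensity :=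
  .of_bound measurable_sellerDensity.aestronglyMeasurable 2 (ae_of_all _ fun s => by
    rw [Real.norm_of_nonneg (sellerDensity_nonneg s)]; exact sellerDensity_le s)

theorem integrable_buyerDensity : Integrable buyerDensity :=
  .of_bound measurable_buyerDensity.aestronglyMeasurable (4 / 3) (ae_of_all _ fun s => by
    rw [Real.norm_of_nonneg (buyerDensity_nonneg s)]; exact buyerDensity_le s)

theorem integral_one_add_sellerTilt (c : ℝ) :
    ∫ s, (1 + c * sellerTilt s) ∂sellerLaw = 1 := by
  -- At price `1` every seller accepts, so the zeroth moment is the total mass. The blocks have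
  -- equal mass, so `c` cancels.
  have := integral_sellerLaw_high (fun _ => 1) continuous_const c (p := 1) (by norm_num)
  simp only [unitInterval.le_one', if_true, mul_one, intervalIntegral.integral_const,
    smul_eq_mul] at this
  rw [this]
  ring

instance : IsProbabilityMeasure sellerLaw := by
  refine isProbabilityMeasure_withDensity_ofReal _ sellerDensity_nonneg integrable_sellerDensity ?_
  have := integral_one_add_sellerTilt 0
  rw [integral_sellerLaw] at this
  simpa using this

instance : IsProbabilityMeasure buyerLaw := by
  refine isProbabilityMeasure_withDensity_ofReal _ buyerDensity_nonneg integrable_buyerDensity ?_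
  have := integral_buyerLaw_low (fun _ => 1) continuous_const (p := 0) (by norm_num)
  rw [integral_buyerLaw] at this
  simp only [unitInterval.nonneg', if_true, mul_one, intervalIntegral.integral_const,
    smul_eq_mul] at this
  rw [this]
  norm_num

/-- The tilted law of the seller's valuation. -/
noncomputable def tiltedSellerLaw (c : ℝ) : Measure unitInterval :=
  sellerLaw.withDensity fun s => ENNReal.ofReal (1 + c * sellerTilt s)

theorem one_add_sellerTilt_nonneg {c : ℝ} (hc : |c| ≤ 1) (s : unitInterval) :
    0 ≤ 1 + c * sellerTilt s := by
  have : |c * sellerTilt s| ≤ 1 := by rw [abs_mul, abs_sellerTilt, mul_one]; exact hc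
  linarith [(abs_le.1 this).1]

theorem one_add_sellerTilt_le {c : ℝ} (s : unitInterval) :
    1 + c * sellerTilt s ≤ 1 + |c| := by
  have := le_abs_self (c * sellerTilt s)
  rw [abs_mul, abs_sellerTilt, mul_one] at this
  linarith

theorem integrable_sellerTilt : Integrable sellerTilt sellerLaw :=
  .of_bound measurable_sellerTilt.aestronglyMeasurable 1
    (ae_of_all _ fun s => (abs_sellerTilt s).le)

theorem isProbabilityMeasure_tiltedSellerLaw {c : ℝ} (hc : |c| ≤ 1) :
    IsProbabilityMeasure (tiltedSellerLaw c) :=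
  isProbabilityMeasure_withDensity_ofReal _ (one_add_sellerTilt_nonneg hc)
    ((integrable_const _).add (integrable_sellerTilt.const_mul _)) (integral_one_add_sellerTilt c)

/-- Tilting only the seller keeps the valuations independent, while the joint law is still a tilt by
a function with values `±1`, as the two-point bound needs. -/
theorem tiltedSellerLaw_prod (c : ℝ) :
    (tiltedSellerLaw c).prod buyerLaw
      = (sellerLaw.prod buyerLaw).withDensity fun y => ENNReal.ofReal (1 + c * sellerTilt y.1) :=
  prod_withDensity_left (f := fun s => ENNReal.ofReal (1 + c * sellerTilt s)) (by fun_prop)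

theorem tiltedSellerLaw_eq_withDensity (c : ℝ) :
    tiltedSellerLaw c = volume.withDensity fun s =>
      ENNReal.ofReal (sellerDensity s * (1 + c * sellerTilt s)) := by
  rw [tiltedSellerLaw, sellerLaw, ← withDensity_mul _ (by fun_prop) (by fun_prop)]
  congr 1
  ext s
  rw [Pi.mul_apply, ENNReal.ofReal_mul (sellerDensity_nonneg s)]

theorem tiltedSellerDensity_mem {c : ℝ} (hc : |c| ≤ 1 / 4) (s : unitInterval) :
    sellerDensity s * (1 + c * sellerTilt s) ∈ Set.Icc (0 : ℝ) (5 / 2) := by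
  have h1 := one_add_sellerTilt_nonneg (hc.trans (by norm_num)) s
  have h2 := one_add_sellerTilt_le (c := c) s
  have h3 := sellerDensity_nonneg s
  have h4 := sellerDensity_le s
  exact ⟨mul_nonneg h3 h1, by nlinarith⟩

theorem hasDensityBoundedBy_tiltedSellerLaw {c M : ℝ} (hc : |c| ≤ 1 / 4) (hM : 4 ≤ M) :
    HasDensityBoundedBy (tiltedSellerLaw c) M :=
  ⟨_, by fun_prop, fun s => ⟨(tiltedSellerDensity_mem hc s).1,
    (tiltedSellerDensity_mem hc s).2.trans (by linarith)⟩, tiltedSellerLaw_eq_withDensity c⟩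

theorem hasDensityBoundedBy_buyerLaw {M : ℝ} (hM : 4 ≤ M) : HasDensityBoundedBy buyerLaw M :=
  ⟨_, measurable_buyerDensity, fun b => ⟨buyerDensity_nonneg b,
    (buyerDensity_le b).trans (by linarith)⟩, rfl⟩

/-- The joint density is at most `5/2 · 4/3 = 10/3`, which is where `M ≥ 4` suffices. -/
theorem hasDensityBoundedBy_prod {c M : ℝ} (hc : |c| ≤ 1 / 4) (hM : 4 ≤ M) :
    HasDensityBoundedBy ((tiltedSellerLaw c).prod buyerLaw) M := by
  refine ⟨fun y => sellerDensity y.1 * (1 + c * sellerTilt y.1) * buyerDensity y.2, by fun_prop,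
    fun y => ?_, ?_⟩
  · have h1 := tiltedSellerDensity_mem hc y.1
    have h2 := buyerDensity_nonneg y.2
    have h3 := buyerDensity_le y.2
    exact ⟨mul_nonneg h1.1 h2, (mul_le_mul h1.2 h3 h2 (by norm_num)).trans (by linarith)⟩
  · rw [tiltedSellerLaw_eq_withDensity, buyerLaw, prod_withDensity (by fun_prop) (by fun_prop)]
    change _ = (volume.prod volume).withDensity _
    congr 1
    ext y
    rw [ENNReal.ofReal_mul (tiltedSellerDensity_mem hc y.1).1]

/-! ### Expected gain from trade in the hard instance. -/

theorem integrable_gainFromTrade (p : unitInterval) (μ : Measure (unitInterval × unitInterval))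
    [IsFiniteMeasure μ] : Integrable (gainFromTrade p) μ :=
  .of_bound (measurable_gainFromTrade.comp
    (measurable_const.prodMk measurable_id)).aestronglyMeasurable 1 (ae_of_all _ fun y => by
      rw [Real.norm_of_nonneg (gainFromTrade_mem p y).1]; exact (gainFromTrade_mem p y).2)

/-- The expected gain from trade in terms of moments of the two valuations. -/
theorem integral_gainFromTrade {c : ℝ} (hc : |c| ≤ 1) (p : unitInterval) :
    ∫ y, gainFromTrade p y ∂((tiltedSellerLaw c).prod buyerLaw)
      = (∫ s, (1 + c * sellerTilt s) * (if s ≤ p then 1 else 0) ∂sellerLaw)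
          * (∫ b, (if p ≤ b then (b : ℝ) else 0) ∂buyerLaw)
        - (∫ s, (1 + c * sellerTilt s) * (if s ≤ p then (s : ℝ) else 0) ∂sellerLaw)
          * (∫ b, (if p ≤ b then 1 else 0) ∂buyerLaw) := by
  have m1 : MeasurableSet {s : unitInterval | s ≤ p} := measurableSet_Iic
  have m2 : MeasurableSet {b : unitInterval | p ≤ b} := measurableSet_Ici
  have hT : ∀ s, |1 + c * sellerTilt s| ≤ 2 := fun s => by
    rw [abs_of_nonneg (one_add_sellerTilt_nonneg hc s)]
    linarith [one_add_sellerTilt_le (c := c) s]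
  have hS : ∀ φ : unitInterval → ℝ, Measurable φ → (∀ s, |φ s| ≤ 1) →
      Integrable (fun s => (1 + c * sellerTilt s) * (if s ≤ p then φ s else 0)) sellerLaw :=
    fun φ hφ hb => .of_bound (Measurable.aestronglyMeasurable (by
      have : Measurable fun s => if s ≤ p then φ s else 0 := Measurable.ite m1 hφ measurable_const
      fun_prop)) 2 (ae_of_all _ fun s => by
        rw [Real.norm_eq_abs, abs_mul]
        have : |if s ≤ p then φ s else 0| ≤ 1 := by split_ifs; exacts [hb s, by simp]
        nlinarith [hT s, abs_nonneg (1 + c * sellerTilt s),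
          abs_nonneg (if s ≤ p then φ s else 0)])
  have hB : ∀ φ : unitInterval → ℝ, Measurable φ → (∀ s, |φ s| ≤ 1) →
      Integrable (fun b => if p ≤ b then φ b else 0) buyerLaw :=
    fun φ hφ hb => .of_bound (Measurable.ite m2 hφ measurable_const).aestronglyMeasurable 1
      (ae_of_all _ fun s => by split_ifs; exacts [hb s, by simp])
  have hu : ∀ s : unitInterval, |(s : ℝ)| ≤ 1 := fun s => by
    rw [abs_of_nonneg s.2.1]; exact s.2.2
  have ho : ∀ s : unitInterval, |(1 : ℝ)| ≤ 1 := fun _ => by simp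
  rw [← integral_prod_mul, ← integral_prod_mul, ← integral_sub
    ((hS _ measurable_const ho).mul_prod (hB _ measurable_subtype_coe hu))
    ((hS _ measurable_subtype_coe hu).mul_prod (hB _ measurable_const ho)),
    tiltedSellerLaw_prod, integral_withDensity_ofReal (f := fun y : unitInterval × unitInterval =>
      1 + c * sellerTilt y.1) _ (by fun_prop) (fun y => one_add_sellerTilt_nonneg hc y.1)]
  refine integral_congr_ae (ae_of_all _ fun y => ?_)
  -- The gain is `(b - s)` times a product of indicators, one in each valuation, so it splits into
  -- two products of one-variable functions.
  by_cases h1 : y.1 ≤ p <;> by_cases h2 : p ≤ y.2 <;> simp [gainFromTrade, h1, h2]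
  ring

/-- The cubic terms in `p` cancel. At `p = 1/4` the value is `(1 + c)/6`. -/
theorem integral_gainFromTrade_low {c : ℝ} (hc : |c| ≤ 1) {p : unitInterval}
    (hp : (p : ℝ) ≤ 1 / 4) :
    ∫ y, gainFromTrade p y ∂((tiltedSellerLaw c).prod buyerLaw)
      = (1 + c) * (11 * p - 12 * (p : ℝ) ^ 2) / 12 := by
  rw [integral_gainFromTrade hc, integral_sellerLaw_low (fun _ => 1) c hp,
    integral_sellerLaw_low (fun x => x) c hp,
    integral_buyerLaw_low (fun _ => 1) continuous_const (hp.trans (by norm_num)),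
    integral_buyerLaw_low (fun x => x) continuous_id (hp.trans (by norm_num))]
  simp only [intervalIntegral.integral_const, integral_id, smul_eq_mul]
  ring

theorem integral_gainFromTrade_high {c : ℝ} (hc : |c| ≤ 1) {p : unitInterval}
    (hp : (p : ℝ) = 3 / 4) :
    ∫ y, gainFromTrade p y ∂((tiltedSellerLaw c).prod buyerLaw) = 1 / 6 + c / 12 := by
  rw [integral_gainFromTrade hc, integral_sellerLaw_high (fun _ => 1) continuous_const c hp.ge,
    integral_sellerLaw_high (fun x => x) continuous_id c hp.ge,
    integral_buyerLaw_high (fun _ => 1) hp, integral_buyerLaw_high (fun x => x) hp]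
  simp only [intervalIntegral.integral_const, integral_id, smul_eq_mul]
  ring

theorem ae_mem_support (c : ℝ) : ∀ᵐ y ∂((tiltedSellerLaw c).prod buyerLaw),
    ((y.1 : ℝ) ≤ 1 / 4 ∨ (1 / 2 < (y.1 : ℝ) ∧ (y.1 : ℝ) ≤ 3 / 4)) ∧
      ((y.2 : ℝ) ≤ 1 / 2 ∨ 3 / 4 ≤ (y.2 : ℝ)) := by
  have hS : ∀ᵐ s : unitInterval ∂sellerLaw, (s : ℝ) ≤ 1 / 4 ∨ (1 / 2 < (s : ℝ) ∧ (s : ℝ) ≤ 3 / 4) := by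
    rw [sellerLaw, ae_withDensity_iff (by fun_prop)]
    refine ae_of_all _ fun s hs => ?_
    by_contra h
    exact hs (by simp only [sellerDensity, h, if_false, ENNReal.ofReal_zero])
  have hB : ∀ᵐ b : unitInterval ∂buyerLaw, (b : ℝ) ≤ 1 / 2 ∨ 3 / 4 ≤ (b : ℝ) := by
    rw [buyerLaw, ae_withDensity_iff (by fun_prop)]
    refine ae_of_all _ fun s hs => ?_
    by_contra h
    exact hs (by simp only [buyerDensity, h, if_false, ENNReal.ofReal_zero])
  rw [tiltedSellerLaw_prod]
  refine (withDensity_absolutelyContinuous _ _).ae_le ?_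
  exact (Measure.quasiMeasurePreserving_fst.ae hS).and (Measure.quasiMeasurePreserving_snd.ae hB)

/-- Every price is dominated, simultaneously for all tilts, by `1 / 4` or by `3 / 4`. -/
theorem integral_gainFromTrade_le (p : unitInterval) :
    (∀ c : ℝ, |c| ≤ 1 →
      ∫ y, gainFromTrade p y ∂((tiltedSellerLaw c).prod buyerLaw) ≤ (1 + c) / 6) ∨
    (∀ c : ℝ, |c| ≤ 1 →
      ∫ y, gainFromTrade p y ∂((tiltedSellerLaw c).prod buyerLaw) ≤ 1 / 6 + c / 12) := by
  rcases le_or_gt (p : ℝ) (1 / 4) with h4 | h4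
  · refine Or.inl fun c hc => ?_
    rw [integral_gainFromTrade_low hc h4]
    have := (abs_le.1 hc).1
    -- `2 - 11p + 12p² = (1 - 4p)(2 - 3p)`, and both factors are nonnegative for `p ≤ 1/4`.
    have h1 : 11 * (p : ℝ) - 12 * (p : ℝ) ^ 2 ≤ 2 := by nlinarith
    nlinarith [mul_nonneg (by linarith : 0 ≤ 1 + c) (sub_nonneg.2 h1)]
  rcases le_or_gt (p : ℝ) (1 / 2) with h2 | h2
  · refine Or.inl fun c hc => ?_
    have := isProbabilityMeasure_tiltedSellerLaw hc
    have hq := integral_gainFromTrade_low hc (p := ⟨1 / 4, by norm_num⟩) le_rfl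
    refine (integral_mono_ae (integrable_gainFromTrade p _)
      (integrable_gainFromTrade ⟨1 / 4, by norm_num⟩ _) ?_).trans (hq.trans_le ?_)
    -- No seller lies in `(1/4, 1/2]`, so lowering the price to `1/4` loses no seller and no buyer.
    · filter_upwards [ae_mem_support c] with y hy
      unfold gainFromTrade
      by_cases h : y.1 ≤ p ∧ p ≤ y.2
      · have hs : (y.1 : ℝ) ≤ p := h.1
        have hb : (p : ℝ) ≤ y.2 := h.2
        have hs' : (y.1 : ℝ) ≤ 1 / 4 := hy.1.resolve_right fun h' => by linarith [h'.1]
        have hq : y.1 ≤ ⟨1 / 4, by norm_num⟩ ∧ (⟨1 / 4, by norm_num⟩ : unitInterval) ≤ y.2 :=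
          ⟨hs', h4.le.trans hb⟩
        rw [if_pos h, if_pos hq]
      · rw [if_neg h]
        exact (gainFromTrade_mem _ _).1
    · simp only
      linarith
  · refine Or.inr fun c hc => ?_
    have := isProbabilityMeasure_tiltedSellerLaw hc
    have hq := integral_gainFromTrade_high hc (p := ⟨3 / 4, by norm_num⟩) rfl
    refine (integral_mono_ae (integrable_gainFromTrade p _)
      (integrable_gainFromTrade ⟨3 / 4, by norm_num⟩ _) ?_).trans hq.le
    -- No buyer lies in `(1/2, 3/4)` and no seller above `3/4`, so every trade made at a price above
    -- `1/2` is also made at `3/4`.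
    filter_upwards [ae_mem_support c] with y hy
    unfold gainFromTrade
    by_cases h : y.1 ≤ p ∧ p ≤ y.2
    · have hb : (p : ℝ) ≤ y.2 := h.2
      have hb' : 3 / 4 ≤ (y.2 : ℝ) := hy.2.resolve_left fun h' => by linarith
      have hs' : (y.1 : ℝ) ≤ 3 / 4 := hy.1.elim (fun h' => h'.trans (by norm_num)) And.right
      have hq : y.1 ≤ ⟨3 / 4, by norm_num⟩ ∧ (⟨3 / 4, by norm_num⟩ : unitInterval) ≤ y.2 :=
        ⟨hs', hb'⟩
      rw [if_pos h, if_pos hq]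
    · rw [if_neg h]
      exact (gainFromTrade_mem _ _).1

/-! ### Choice of the tilt and conclusion. -/

/-- The `√T` lower bound for every class of laws that contains the i.i.d. sequences of pairs with
a slightly tilted seller's valuation. -/
theorem sqrt_le_minimaxRegret (P : Set (ProbabilityMeasure (ℕ → unitInterval × unitInterval)))
    (hP : ∀ c : ℝ, |c| ≤ 1 / 4 → ∀ ν : ProbabilityMeasure (ℕ → unitInterval × unitInterval),
      (ν : Measure (ℕ → unitInterval × unitInterval)) =
        Measure.infinitePi (fun _ : ℕ => (tiltedSellerLaw c).prod buyerLaw) → ν ∈ P) (T : ℕ) :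
    ((1 / 160 * Real.sqrt (T : ℝ) : ℝ) : EReal) ≤ (fullFeedbackGame P).minimaxRegret T := by
  -- The largest tilt with `T ε² ≤ 1/16`. For `T = 0`, division by zero gives `ε = 0`, which is
  -- harmless.
  set ε : ℝ := 1 / (4 * Real.sqrt T) with hεdef
  have hε0 : 0 ≤ ε := by positivity
  have hεle : ε ≤ 1 / 4 := by
    rcases Nat.eq_zero_or_pos T with rfl | hT
    · simp [hεdef]
    · have : 1 ≤ Real.sqrt T := Real.one_le_sqrt.2 (by exact_mod_cast hT)
      rw [hεdef]
      exact one_div_le_one_div_of_le (by norm_num) (by linarith)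
  have hTε : T * ε ^ 2 ≤ 1 / 16 := by
    rcases Nat.eq_zero_or_pos T with rfl | hT
    · simp
    · rw [hεdef, div_pow, mul_pow, Real.sq_sqrt (Nat.cast_nonneg T)]
      have : (T : ℝ) ≠ 0 := by exact_mod_cast hT.ne'
      field_simp
      norm_num
  have hεT : ε * T = Real.sqrt T / 4 := by
    rw [hεdef, one_div, mul_inv, mul_assoc, mul_comm _ (T : ℝ), ← div_eq_mul_inv,
      Real.div_sqrt]
    ring
  have habs : |ε| ≤ 1 / 4 := by rwa [abs_of_nonneg hε0]
  have habs' : |-ε| ≤ 1 / 4 := by rwa [abs_neg]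
  have hp := isProbabilityMeasure_tiltedSellerLaw (habs.trans (by norm_num))
  have hm := isProbabilityMeasure_tiltedSellerLaw (habs'.trans (by norm_num))
  have ep := tiltedSellerLaw_prod ε
  have em := tiltedSellerLaw_prod (-ε)
  simp only [neg_mul, ← sub_eq_add_neg] at em
  have hip : IsProbabilityMeasure ((sellerLaw.prod buyerLaw).withDensity fun y =>
      ENNReal.ofReal (1 + ε * sellerTilt y.1)) := by rw [← ep]; infer_instance
  have him : IsProbabilityMeasure ((sellerLaw.prod buyerLaw).withDensity fun y =>
      ENNReal.ofReal (1 - ε * sellerTilt y.1)) := by rw [← em]; infer_instance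
  -- The mass of the tilted law does not depend on `c`; comparing `c = 1` with the untilted mass
  -- shows that the tilt has mean zero.
  have h0 : ∫ y, sellerTilt y.1 ∂(sellerLaw.prod buyerLaw) = 0 := by
    have h1 := integral_one_add_sellerTilt 1
    rw [integral_add (integrable_const _) (integrable_sellerTilt.const_mul _)] at h1
    have h2 := integral_prod_mul (μ := sellerLaw) (ν := buyerLaw) sellerTilt (fun _ => (1 : ℝ))
    simp only [mul_one, one_mul, integral_const, probReal_univ, smul_eq_mul] at h1 h2
    linarith
  have hgap : ∀ (c : ℝ), |c| ≤ 1 → ∀ q p : unitInterval,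
      ∫ y, (gainFromTrade q y - gainFromTrade p y) ∂((tiltedSellerLaw c).prod buyerLaw)
        = ∫ y, gainFromTrade q y ∂((tiltedSellerLaw c).prod buyerLaw)
          - ∫ y, gainFromTrade p y ∂((tiltedSellerLaw c).prod buyerLaw) := fun c hc q p => by
    have := isProbabilityMeasure_tiltedSellerLaw hc
    exact integral_sub (integrable_gainFromTrade q _) (integrable_gainFromTrade p _)
  have hε1 : |ε| ≤ 1 := habs.trans (by norm_num)
  have hε1' : |-ε| ≤ 1 := habs'.trans (by norm_num)
  have vp := integral_gainFromTrade_low hε1 (p := ⟨1 / 4, by norm_num⟩) le_rfl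
  have vm := integral_gainFromTrade_high hε1' (p := ⟨3 / 4, by norm_num⟩) rfl
  simp only at vp
  refine le_trans ?_ (SequentialGame.le_minimaxRegret_of_two_point (fullFeedbackGame P)
    (fun _ _ => rfl) (sellerLaw.prod buyerLaw) (h := fun y => sellerTilt y.1) (by fun_prop)
    (fun y => sellerTilt_sq y.1) h0 hTε hε1
    (νp := ⟨Measure.infinitePi fun _ => (tiltedSellerLaw ε).prod buyerLaw, inferInstance⟩)
    (νm := ⟨Measure.infinitePi fun _ => (tiltedSellerLaw (-ε)).prod buyerLaw, inferInstance⟩)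
    (hP ε habs _ rfl) (hP (-ε) habs' _ rfl) (by rw [← ep]; rfl) (by rw [← em]; rfl)
    (xp := ⟨1 / 4, by norm_num⟩) (xm := ⟨3 / 4, by norm_num⟩) (δ := ε / 12) (by positivity)
    ?_ ?_ ?_)
  · rw [EReal.coe_le_coe_iff]
    have : 7 / 20 * (ε / 12) * T = 7 / 960 * Real.sqrt T := by
      linear_combination (7 / 240 : ℝ) * hεT
    rw [this]
    linarith [Real.sqrt_nonneg (T : ℝ)]
  -- A price dominated by `1/4` loses at least `ε/12` under `-ε`; one dominated by `3/4` loses at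
  -- least `ε/12` under `ε`. The same alternative must serve both tilts, hence the quantifier over
  -- `c` inside each disjunct of `integral_gainFromTrade_le`.
  all_goals
    intro p
    simp only [fullFeedbackGame]
    simp only [← ep, ← em, hgap _ hε1, hgap _ hε1', vp, vm]
    rcases integral_gainFromTrade_le p with h | h
  all_goals
    have h1 := h ε hε1
    have h2 := h (-ε) hε1'
    linarith

end BilateralTrade

theorem mainTheorem2 (M : ℝ) (hM : 4 ≤ M) (T : ℕ) :
    ((1 / 160 * Real.sqrt (T : ℝ) : ℝ) : EReal) ≤
        (BilateralTrade.fullFeedbackGame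
          (BilateralTrade.behaviorIVMarginalBD M)).minimaxRegret T ∧
      ((1 / 160 * Real.sqrt (T : ℝ) : ℝ) : EReal) ≤
        (BilateralTrade.fullFeedbackGame
          (BilateralTrade.behaviorIV ∩ BilateralTrade.behaviorBD M)).minimaxRegret T := by
  refine ⟨BilateralTrade.sqrt_le_minimaxRegret _ (fun c hc ν hν => ?_) T,
    BilateralTrade.sqrt_le_minimaxRegret _ (fun c hc ν hν => ?_) T⟩
  all_goals
    have := BilateralTrade.isProbabilityMeasure_tiltedSellerLaw (hc.trans (by norm_num))
  · exact ⟨⟨BilateralTrade.tiltedSellerLaw c, this⟩, ⟨BilateralTrade.buyerLaw, inferInstance⟩,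
      BilateralTrade.hasDensityBoundedBy_tiltedSellerLaw hc hM,
      BilateralTrade.hasDensityBoundedBy_buyerLaw hM, hν⟩
  · exact ⟨⟨⟨BilateralTrade.tiltedSellerLaw c, this⟩, ⟨BilateralTrade.buyerLaw, inferInstance⟩, hν⟩,
      ⟨⟨(BilateralTrade.tiltedSellerLaw c).prod BilateralTrade.buyerLaw, inferInstance⟩,
        BilateralTrade.hasDensityBoundedBy_prod hc hM, hν⟩⟩
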